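/- Let $G$ be a compact Hausdorff group with normalized Haar (Radon) measure $m_G$. For each class $[\pi]\in\widehat G$ in the unitary dual fix a representative $\pi$ on a Hilbert space $\mathcal H_\pi$ of finite dimension $d_\pi$, and equip the space $\mathcal B(\mathcal H_\pi)$ of all operators on $\mathcal H_\pi$ with a norm $\|\cdot\|_\pi$, in such a way that for some constant $C$ independent of $\pi$ $$\|T\|_\pi\le C\,\|T\|_{\mathrm{op}}\qquad(T\in\mathcal B(\mathcal H_\pi),\ [\pi]\in\widehat G).$$ (This holds, for example, for the operator norm, for the normalized Hilbert--Schmidt norm $(\operatorname{tr}(T^*T)/d_\pi)^{1/2}$, and, if $\sup_\pi d_\pi<\infty$, for the Hilbert--Schmidt norm itself.) Let $c_0(\widehat G)$ denote the $c_0$-direct sum of the spaces $(\mathcal B(\mathcal H_\pi),\|\cdot\|_\pi)$, $[\pi]\in\widehat G$, with the supremum norm, and for $f\in L^1(G)$ let $\widehat f(\pi)=\int_G f(t)\,\pi(t)^*\,dm_G(t)$. Let $\Phi:[0,\infty)\to[0,\infty]$ be a Young function, i.e. $\Phi$ is convex, $\Phi(0)=0$, $\lim_{x\to\infty}\Phi(x)=\infty$,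 and $\Phi(x)<\infty$ for some $x>0$. Assume that $\Phi$ satisfies the $\Delta_2$-condition: there are $K,x_0>0$ with $\Phi(2x)\le K\Phi(x)$ for all $x\ge x_0$. Let $L^\Phi(G)$ be the Orlicz space of complex measurable functions with finite Luxemburg norm $\|f\|_\Phi=\inf\{k>0:\int_G\Phi(|f|/k)\,dm_G\le1\}$. For a vector measure $\nu$ on the Borel sets of $G$ with values in a complex normed space $X$, a function $f:G\to\mathbb C$ belongs to $L^1(\nu)$ if $f\in L^1(|\langle\nu,x'\rangle|)$ for all $x'\in X'$ and for every Borel set $A$ there is a unique $\int_A f\,d\nu\in X$ with $\int_A f\,d\langle\nu,x'\rangle=\langle\int_A f\,d\nu,x'\rangle$ for all $x'\in X'$. Put $\|f\|_\nu=\sup_{\|x'\|\le1}\int_G|f|\,d|\langle\nu,x'\rangle|$ and $I_\nu(f)=\int_Gf\,d\nu$. Then $\mathscr F_{\Phi,0}(f)=\widehat f$ defines a bounded linear operator $\mathscr F_{\Phi,0}:L^\Phi(G)\to c_0(\widehat G)$, and $\nu_{\Phi,0}(A)=\mathscr F_{\Phi,0}(\chi_A)$ defines a ($\sigma$-additive)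 $c_0(\widehat G)$-valued vector measure on the Borel sets of $G$. Moreover: 1. the optimal domain $L^1(\nu_{\Phi,0})$ of $\mathscr F_{\Phi,0}$ coincides with $L^1(G)$: a function $f:G\to\mathbb C$ is $\nu_{\Phi,0}$-integrable if and only if it is $m_G$-integrable, and the norms $\|\cdot\|_{\nu_{\Phi,0}}$ and $\|\cdot\|_1$ are equivalent (so that the same functions are identified in both spaces); 2. the extended operator $I_{\nu_{\Phi,0}}$ is the Fourier transform on $L^1(G)$: $I_{\nu_{\Phi,0}}(f)=\widehat f\in c_0(\widehat G)$ for every $f\in L^1(G)$. -/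

import Mathlib

open MeasureTheory Filter Topology
open scoped ENNReal NNReal

noncomputable section

/-! ### Young functions and Orlicz spaces -/

/-- A Young function, as a function of a finite argument `x ∈ [0, ∞)` (its value at `∞` plays no
role for complex valued functions); the value `∞` is allowed. The last field excludes
the function that is `∞` on all of `(0, ∞)`, whose complementary function `0` is not a
Young function. -/
structure YoungFunction where
  toFun : ℝ≥0 → ℝ≥0∞
  convex : ConvexOn ℝ≥0 Set.univ toFun
  map_zero : toFun 0 = 0
  tendsto_top : Tendsto toFun atTop (𝓝 ∞)
  exists_ne_top : ∃ x, 0 < x ∧ toFun x ≠ ∞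

namespace YoungFunction

instance : CoeFun YoungFunction (fun _ => ℝ≥0 → ℝ≥0∞) := ⟨toFun⟩

/-- The `Δ₂`-condition (for large arguments). -/
def DeltaTwo (Φ : YoungFunction) : Prop :=
  ∃ K : ℝ≥0, 0 < K ∧ ∃ x₀ : ℝ≥0, 0 < x₀ ∧ ∀ x, x₀ ≤ x → Φ (2 * x) ≤ K * Φ x

theorem map_mul_le (Φ : YoungFunction) {a : ℝ≥0} (ha : a ≤ 1) (x : ℝ≥0) :
    Φ (a * x) ≤ a * Φ x := by
  have h := Φ.convex.2 (Set.mem_univ x) (Set.mem_univ 0) (zero_le) (zero_le)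
    (add_tsub_cancel_of_le ha)
  simpa [Φ.map_zero, ENNReal.smul_def] using h

theorem monotone (Φ : YoungFunction) : Monotone Φ := by
  intro x y hxy
  rcases eq_or_ne y 0 with rfl | hy
  · rw [le_antisymm hxy zero_le]
  · have h := Φ.map_mul_le (a := x / y) (div_le_one_of_le₀ hxy zero_le) y
    rw [div_mul_cancel₀ _ hy] at h
    refine h.trans (mul_le_of_le_one_left zero_le ?_)
    exact_mod_cast div_le_one_of_le₀ hxy zero_le

theorem measurable (Φ : YoungFunction) : Measurable Φ := Φ.monotone.measurable

end YoungFunction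

section Orlicz

variable {α : Type*} [MeasurableSpace α]

/-- The modular `∫ Φ(|f| / k) dμ`. -/
def orliczModular (Φ : YoungFunction) (μ : Measure α) (f : α →ₘ[μ] ℂ) (k : ℝ≥0) : ℝ≥0∞ :=
  ∫⁻ t, Φ (‖f t‖₊ / k) ∂μ

/-- The admissible constants in the definition of the Luxemburg norm. -/
def luxemburgSet (Φ : YoungFunction) (μ : Measure α) (f : α →ₘ[μ] ℂ) : Set ℝ≥0 :=
  {k | 0 < k ∧ orliczModular Φ μ f k ≤ 1}

variable {Φ : YoungFunction} {μ : Measure α}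

theorem luxemburgSet_mono {f : α →ₘ[μ] ℂ} {k l : ℝ≥0} (hk : k ∈ luxemburgSet Φ μ f)
    (hkl : k ≤ l) : l ∈ luxemburgSet Φ μ f :=
  ⟨hk.1.trans_le hkl, (lintegral_mono fun _ => Φ.monotone
    (div_le_div_of_nonneg_left zero_le hk.1 hkl)).trans hk.2⟩

theorem zero_luxemburgSet {k : ℝ≥0} (hk : 0 < k) : k ∈ luxemburgSet Φ μ 0 := by
  refine ⟨hk, ?_⟩
  have : orliczModular Φ μ 0 k = ∫⁻ _, 0 ∂μ := by
    refine lintegral_congr_ae ?_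
    filter_upwards [AEEqFun.coeFn_zero (μ := μ) (β := ℂ)] with t ht
    simp [ht, Φ.map_zero]
  rw [this]; simp

theorem add_luxemburgSet {f g : α →ₘ[μ] ℂ} {k l : ℝ≥0} (hk : k ∈ luxemburgSet Φ μ f)
    (hl : l ∈ luxemburgSet Φ μ g) : k + l ∈ luxemburgSet Φ μ (f + g) := by
  have hkl : 0 < k + l := add_pos hk.1 hl.1
  refine ⟨hkl, ?_⟩
  have hsum : k / (k + l) + l / (k + l) = 1 := by
    rw [← add_div, div_self hkl.ne']
  have hm : Measurable fun t => Φ (‖f t‖₊ / k) :=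
    Φ.measurable.comp (f.stronglyMeasurable.measurable.nnnorm.div_const k)
  have hm' : Measurable fun t => Φ (‖g t‖₊ / l) :=
    Φ.measurable.comp (g.stronglyMeasurable.measurable.nnnorm.div_const l)
  calc orliczModular Φ μ (f + g) (k + l)
      ≤ ∫⁻ t, ((k / (k + l) : ℝ≥0) : ℝ≥0∞) * Φ (‖f t‖₊ / k)
          + ((l / (k + l) : ℝ≥0) : ℝ≥0∞) * Φ (‖g t‖₊ / l) ∂μ := by
        refine lintegral_mono_ae ?_
        filter_upwards [AEEqFun.coeFn_add f g] with t ht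
        have h := Φ.convex.2 (Set.mem_univ (‖f t‖₊ / k)) (Set.mem_univ (‖g t‖₊ / l))
          zero_le zero_le hsum
        simp only [ENNReal.smul_def, smul_eq_mul] at h
        refine le_trans (Φ.monotone ?_) h
        rw [ht, Pi.add_apply, div_mul_div_comm, div_mul_div_comm, mul_comm k, mul_comm l,
          mul_div_mul_right _ _ hk.1.ne', mul_div_mul_right _ _ hl.1.ne', ← add_div]
        gcongr
        exact nnnorm_add_le _ _
    _ = ((k / (k + l) : ℝ≥0) : ℝ≥0∞) * orliczModular Φ μ f k
          + ((l / (k + l) : ℝ≥0) : ℝ≥0∞) * orliczModular Φ μ g l := by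
        rw [lintegral_add_left (hm.const_mul _), lintegral_const_mul _ hm,
          lintegral_const_mul _ hm']
        rfl
    _ ≤ ((k / (k + l) : ℝ≥0) : ℝ≥0∞) * 1 + ((l / (k + l) : ℝ≥0) : ℝ≥0∞) * 1 := by
        gcongr
        · exact hk.2
        · exact hl.2
    _ = 1 := by rw [mul_one, mul_one, ← ENNReal.coe_add, hsum, ENNReal.coe_one]

theorem smul_luxemburgSet {f : α →ₘ[μ] ℂ} {k : ℝ≥0} (hk : k ∈ luxemburgSet Φ μ f)
    {c : ℂ} (hc : c ≠ 0) : ‖c‖₊ * k ∈ luxemburgSet Φ μ (c • f) := by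
  have hc' : 0 < ‖c‖₊ := by simpa using hc
  refine ⟨mul_pos hc' hk.1, le_trans (le_of_eq ?_) hk.2⟩
  refine lintegral_congr_ae ?_
  filter_upwards [AEEqFun.coeFn_smul c f] with t ht
  rw [ht, Pi.smul_apply, nnnorm_smul, mul_div_mul_left _ _ hc'.ne']

theorem eq_zero_of_orliczModular_le {f : α →ₘ[μ] ℂ}
    (hall : ∀ k : ℝ≥0, 0 < k → orliczModular Φ μ f k ≤ 1) : f = 0 := by
  have hmeas : ∀ n : ℕ, Measurable fun t => Φ (‖f t‖₊ * ((n : ℝ≥0) + 1)) :=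
    fun n => Φ.measurable.comp (f.stronglyMeasurable.measurable.nnnorm.mul_const _)
  have hlim : ∫⁻ t, liminf (fun n : ℕ => Φ (‖f t‖₊ * ((n : ℝ≥0) + 1))) atTop ∂μ ≤ 1 := by
    refine (lintegral_liminf_le hmeas).trans ?_
    refine (liminf_le_liminf (v := fun _ => (1 : ℝ≥0∞))
      (Eventually.of_forall fun n => ?_)).trans (liminf_const _).le
    have h := hall ((n : ℝ≥0) + 1)⁻¹ (by positivity)
    simpa only [orliczModular, div_inv_eq_mul] using h
  have hae := ae_lt_top (Measurable.liminf hmeas) (ne_top_of_le_ne_top ENNReal.one_ne_top hlim)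
  refine AEEqFun.ext ?_
  filter_upwards [hae, AEEqFun.coeFn_zero (μ := μ) (β := ℂ)] with t ht h0
  rw [h0, Pi.zero_apply]
  by_contra hne
  have hpos : 0 < ‖f t‖₊ := by simpa using hne
  have hn : Tendsto (fun n : ℕ => (n : ℝ≥0) + 1) atTop atTop :=
    tendsto_atTop_mono (fun n => le_add_of_nonneg_right zero_le) tendsto_natCast_atTop_atTop
  have ht' : Tendsto (fun n : ℕ => ‖f t‖₊ * ((n : ℝ≥0) + 1)) atTop atTop :=
    hn.const_mul_atTop hpos
  exact ht.ne (Φ.tendsto_top.comp ht').liminf_eq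

variable (Φ μ) in
/-- The (classes of) complex measurable functions with finite Luxemburg norm. -/
def orliczSubmodule : Submodule ℂ (α →ₘ[μ] ℂ) where
  carrier := {f | (luxemburgSet Φ μ f).Nonempty}
  zero_mem' := ⟨1, zero_luxemburgSet one_pos⟩
  add_mem' := by
    rintro f g ⟨k, hk⟩ ⟨l, hl⟩
    exact ⟨k + l, add_luxemburgSet hk hl⟩
  smul_mem' := by
    rintro c f ⟨k, hk⟩
    rcases eq_or_ne c 0 with rfl | hc
    · exact ⟨1, by rw [zero_smul]; exact zero_luxemburgSet one_pos⟩
    · exact ⟨_, smul_luxemburgSet hk hc⟩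

variable (Φ μ) in
/-- The Orlicz space `L^Φ(μ)`, normed by the Luxemburg norm below. -/
def OrliczSpace : Type _ := ↥(orliczSubmodule Φ μ)

namespace OrliczSpace

instance : AddCommGroup (OrliczSpace Φ μ) :=
  inferInstanceAs (AddCommGroup ↥(orliczSubmodule Φ μ))

instance : Module ℂ (OrliczSpace Φ μ) :=
  inferInstanceAs (Module ℂ ↥(orliczSubmodule Φ μ))

/-- The class of functions underlying an element of the Orlicz space. -/
def toAEEqFun (f : OrliczSpace Φ μ) : α →ₘ[μ] ℂ := Subtype.val f

/-- The Luxemburg norm `inf {k > 0 : ∫ Φ(|f| / k) dμ ≤ 1}`. -/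
instance : Norm (OrliczSpace Φ μ) := ⟨fun f => ↑(sInf (luxemburgSet Φ μ f.toAEEqFun))⟩

theorem norm_def (f : OrliczSpace Φ μ) :
    ‖f‖ = ↑(sInf (luxemburgSet Φ μ f.toAEEqFun)) := rfl

theorem luxemburgSet_nonempty (f : OrliczSpace Φ μ) :
    (luxemburgSet Φ μ f.toAEEqFun).Nonempty := f.2

theorem norm_smul_le' (c : ℂ) (f : OrliczSpace Φ μ) : ‖c • f‖ ≤ ‖c‖ * ‖f‖ := by
  rcases eq_or_ne c 0 with rfl | hc
  · have h0 : sInf (luxemburgSet Φ μ (0 : α →ₘ[μ] ℂ)) = 0 := by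
      refine le_antisymm (le_of_forall_pos_le_add fun ε hε => ?_) zero_le
      rw [zero_add]
      exact csInf_le' (zero_luxemburgSet hε)
    have : ‖(0 : ℂ) • f‖ = 0 := by
      rw [zero_smul, norm_def]
      exact_mod_cast h0
    rw [this]; simp
  · have hc' : 0 < ‖c‖₊ := by simpa using hc
    have : sInf (luxemburgSet Φ μ (c • f).toAEEqFun)
        ≤ ‖c‖₊ * sInf (luxemburgSet Φ μ f.toAEEqFun) := by
      rw [mul_comm, ← div_le_iff₀ hc']
      refine le_csInf f.luxemburgSet_nonempty fun k hk => ?_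
      rw [div_le_iff₀ hc', mul_comm]
      exact csInf_le' (smul_luxemburgSet hk hc)
    rw [norm_def, norm_def, ← coe_nnnorm c, ← NNReal.coe_mul]
    exact_mod_cast this

theorem norm_core : NormedSpace.Core ℂ (OrliczSpace Φ μ) where
  norm_nonneg f := NNReal.coe_nonneg _
  norm_smul c f := by
    refine le_antisymm (norm_smul_le' c f) ?_
    rcases eq_or_ne c 0 with rfl | hc
    · simp only [norm_zero, zero_mul]; exact NNReal.coe_nonneg _
    · have h := norm_smul_le' c⁻¹ (c • f)
      rw [inv_smul_smul₀ hc, norm_inv] at h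
      rwa [inv_mul_eq_div, le_div_iff₀' (norm_pos_iff.2 hc)] at h
  norm_triangle f g := by
    rw [norm_def, norm_def, norm_def]
    have : sInf (luxemburgSet Φ μ (f + g).toAEEqFun)
        ≤ sInf (luxemburgSet Φ μ f.toAEEqFun) + sInf (luxemburgSet Φ μ g.toAEEqFun) := by
      refine le_of_forall_pos_le_add fun ε hε => ?_
      obtain ⟨k, hk, hk'⟩ := exists_lt_of_csInf_lt f.luxemburgSet_nonempty
        (lt_add_of_pos_right (sInf (luxemburgSet Φ μ f.toAEEqFun)) (half_pos hε))
      obtain ⟨l, hl, hl'⟩ := exists_lt_of_csInf_lt g.luxemburgSet_nonempty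
        (lt_add_of_pos_right (sInf (luxemburgSet Φ μ g.toAEEqFun)) (half_pos hε))
      refine (csInf_le' (add_luxemburgSet hk hl)).trans ((add_le_add hk'.le hl'.le).trans ?_)
      rw [add_add_add_comm, add_halves]
    exact_mod_cast this
  norm_eq_zero_iff f := by
    constructor
    · intro h
      rw [norm_def, NNReal.coe_eq_zero] at h
      have hall : ∀ k : ℝ≥0, 0 < k → orliczModular Φ μ f.toAEEqFun k ≤ 1 := by
        intro k hk
        obtain ⟨l, hl, hl'⟩ := exists_lt_of_csInf_lt f.luxemburgSet_nonempty (h.trans_lt hk)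
        exact (luxemburgSet_mono hl hl'.le).2
      have : f.toAEEqFun = 0 := eq_zero_of_orliczModular_le hall
      exact Subtype.ext this
    · rintro rfl
      have := norm_smul_le' (0 : ℂ) (0 : OrliczSpace Φ μ)
      rw [zero_smul, norm_zero, zero_mul] at this
      exact le_antisymm this (NNReal.coe_nonneg _)

instance : NormedAddCommGroup (OrliczSpace Φ μ) := NormedAddCommGroup.ofCore norm_core

instance : NormedSpace ℂ (OrliczSpace Φ μ) := NormedSpace.ofCore norm_core

variable (Φ) in
theorem indicator_mem [IsFiniteMeasure μ] {A : Set α} (hA : MeasurableSet A) :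
    AEEqFun.mk (A.indicator fun _ => (1 : ℂ))
      (aestronglyMeasurable_const.indicator hA) ∈ orliczSubmodule Φ μ := by
  obtain ⟨x, hx, hxt⟩ := Φ.exists_ne_top
  set M : ℝ≥0 := (Φ x).toNNReal * (μ Set.univ).toNNReal with hM
  set a : ℝ≥0 := (M + 1)⁻¹ with ha
  have ha0 : 0 < a := by positivity
  have ha1 : a ≤ 1 := inv_le_one_of_one_le₀ (by simp)
  refine ⟨(a * x)⁻¹, by positivity, ?_⟩
  calc orliczModular Φ μ _ (a * x)⁻¹ ≤ ∫⁻ _, a * Φ x ∂μ := by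
        refine lintegral_mono_ae ?_
        filter_upwards [AEEqFun.coeFn_mk (A.indicator fun _ => (1 : ℂ))
          (aestronglyMeasurable_const.indicator (μ := μ) hA)] with t ht
        rw [ht]
        refine le_trans (Φ.monotone ?_) (Φ.map_mul_le ha1 x)
        rw [div_inv_eq_mul]
        refine mul_le_of_le_one_left zero_le ?_
        by_cases h : t ∈ A <;> simp [h]
    _ = ((a * M : ℝ≥0) : ℝ≥0∞) := by
        rw [lintegral_const, hM, ENNReal.coe_mul, ENNReal.coe_mul, ENNReal.coe_toNNReal hxt,
          ENNReal.coe_toNNReal (measure_ne_top μ _), mul_assoc]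
    _ ≤ 1 := by
        have : a * M ≤ 1 := by
          rw [ha, inv_mul_eq_div]
          exact div_le_one_of_le₀ (by simp) zero_le
        exact_mod_cast this

variable (Φ μ) in
/-- The characteristic function `χ_A` of a measurable set as an element of `L^Φ(μ)`. -/
def indicator [IsFiniteMeasure μ] (A : Set α) (hA : MeasurableSet A) : OrliczSpace Φ μ :=
  ⟨_, indicator_mem Φ hA⟩

end OrliczSpace

end Orlicz

/-! ### The `c₀`-direct sum -/

section C0

variable {ι : Type*} (V : ι → Type*) [∀ i, NormedAddCommGroup (V i)] [∀ i, NormedSpace ℂ (V i)]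

/-- The `c₀`-direct sum of Banach spaces: the subspace of the `ℓ^∞`-direct sum
consisting of the families whose norms tend to `0` along the discrete index set. -/
def c0Sum : Submodule ℂ (lp V ∞) where
  carrier := {x | Tendsto (fun i => ‖x i‖) cofinite (𝓝 0)}
  zero_mem' := by
    have : (fun i => ‖(0 : lp V ∞) i‖) = fun _ => (0 : ℝ) := by ext i; simp
    change Tendsto (fun i => ‖(0 : lp V ∞) i‖) cofinite (𝓝 0)
    rw [this]
    exact tendsto_const_nhds
  add_mem' := by
    intro x y hx hy
    refine squeeze_zero (fun _ => norm_nonneg _) (fun i => norm_add_le (x i) (y i)) ?_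
    simpa using hx.add hy
  smul_mem' := by
    intro c x hx
    have := hx.const_mul ‖c‖
    simpa [norm_smul] using this

end C0

/-! ### Integration with respect to a vector measure -/

namespace MeasureTheory.VectorMeasure

section Weak

variable {α : Type*} [MeasurableSpace α] {X : Type*} [NormedAddCommGroup X] [NormedSpace ℂ X]

/-- The scalar measure `⟨ν, x'⟩ : A ↦ ⟨ν(A), x'⟩`. -/
def scalar (ν : VectorMeasure α X) (x' : StrongDual ℂ X) : ComplexMeasure α :=
  ν.mapRange (x' : X →+ ℂ) x'.continuous

/-- The integral `∫_A f d⟨ν, x'⟩`. -/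
def scalarIntegral (ν : VectorMeasure α X) (x' : StrongDual ℂ X) (f : α → ℂ) (A : Set α) : ℂ :=
  ((ν.scalar x').restrict A).integral f (ContinuousLinearMap.mul ℝ ℂ)

/-- `f` is `ν`-weakly integrable: `f ∈ L¹(|⟨ν, x'⟩|)` for every `x'`. -/
def IsWeaklyIntegrable (ν : VectorMeasure α X) (f : α → ℂ) : Prop :=
  ∀ x' : StrongDual ℂ X, MeasureTheory.Integrable f (ν.scalar x').variation

/-- `y` is a value of the integral `∫_A f dν`. -/
def IsIntegralOn (ν : VectorMeasure α X) (f : α → ℂ) (A : Set α) (y : X) : Prop :=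
  ∀ x' : StrongDual ℂ X, ν.scalarIntegral x' f A = x' y

/-- `f` is `ν`-integrable, i.e. `f ∈ L¹(ν)`. -/
def IsIntegrable (ν : VectorMeasure α X) (f : α → ℂ) : Prop :=
  ν.IsWeaklyIntegrable f ∧ ∀ A, MeasurableSet A → ∃! y : X, ν.IsIntegralOn f A y

/-- The norm `‖f‖_ν = sup {∫ |f| d|⟨ν, x'⟩| : ‖x'‖ ≤ 1}` of `L¹(ν)`. -/
def l1Norm (ν : VectorMeasure α X) (f : α → ℂ) : ℝ≥0∞ :=
  ⨆ x' ∈ {x' : StrongDual ℂ X | ‖x'‖ ≤ 1}, ∫⁻ t, ‖f t‖ₑ ∂(ν.scalar x').variation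

open Classical in
/-- The integration operator `I_ν(f) = ∫ f dν` (with value `0` off `L¹(ν)`). -/
def integrationOperator (ν : VectorMeasure α X) (f : α → ℂ) : X :=
  if h : ν.IsIntegrable f then (h.2 Set.univ MeasurableSet.univ).choose else 0

end Weak

end MeasureTheory.VectorMeasure

/-! ### The unitary dual and the Fourier transform -/

section Fourier

/-- A continuous irreducible unitary representation on the Hilbert space `ℂ^dim` (all continuous
irreducible unitary representations of a compact group are finite-dimensional). -/
structure UnitaryIrrep (G : Type*) [Group G] [TopologicalSpace G] where
  dim : ℕ
  toHom : G →* unitary (EuclideanSpace ℂ (Fin dim) →L[ℂ] EuclideanSpace ℂ (Fin dim))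
  continuous' : ∀ v : EuclideanSpace ℂ (Fin dim), Continuous fun t =>
    (toHom t : EuclideanSpace ℂ (Fin dim) →L[ℂ] EuclideanSpace ℂ (Fin dim)) v
  irreducible : Representation.IsIrreducible
    ((ContinuousLinearMap.toLinearMapRingHom : (EuclideanSpace ℂ (Fin dim) →L[ℂ]
        EuclideanSpace ℂ (Fin dim)) →+* _).toMonoidHom.comp ((unitary _).subtype.comp toHom) :
      Representation ℂ G (EuclideanSpace ℂ (Fin dim)))

variable {G : Type*} [Group G] [TopologicalSpace G]

namespace UnitaryIrrep

/-- The representation space `H_π`. -/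
abbrev Space (π : UnitaryIrrep G) : Type := EuclideanSpace ℂ (Fin π.dim)

/-- The operator `π(t)`. -/
def op (π : UnitaryIrrep G) (t : G) : π.Space →L[ℂ] π.Space := π.toHom t

/-- Unitary equivalence. -/
instance setoid : Setoid (UnitaryIrrep G) where
  r π σ := ∃ U : π.Space ≃ₗᵢ[ℂ] σ.Space, ∀ t v, U (π.op t v) = σ.op t (U v)
  iseqv :=
    { refl := fun π => ⟨LinearIsometryEquiv.refl ℂ _, fun _ _ => rfl⟩
      symm := by
        rintro π σ ⟨U, hU⟩
        refine ⟨U.symm, fun t v => ?_⟩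
        rw [LinearIsometryEquiv.symm_apply_eq, hU, LinearIsometryEquiv.apply_symm_apply]
      trans := by
        rintro π σ τ ⟨U, hU⟩ ⟨W, hW⟩
        exact ⟨U.trans W, fun t v => by simp [hU, hW]⟩ }

variable [MeasurableSpace G]

/-- The Fourier coefficient `∫ f(t) π(t)^* dm(t)`. -/
def fourierCoeff (π : UnitaryIrrep G) (m : Measure G) (f : G → ℂ) : π.Space →L[ℂ] π.Space :=
  ∫ t, f t • star (π.op t) ∂m

end UnitaryIrrep

variable (G) in
/-- The unitary dual of `G`. -/
def UnitaryDual : Type _ := Quotient (UnitaryIrrep.setoid (G := G))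

/-- A fixed representative of a class in the unitary dual. -/
def UnitaryDual.rep (p : UnitaryDual G) : UnitaryIrrep G := Quotient.out p

/-- The algebra `𝓑(H_π)` of operators on the space of the representative. -/
abbrev UnitaryDual.Operators (p : UnitaryDual G) : Type := p.rep.Space →L[ℂ] p.rep.Space

end Fourier

end

/-! A Young function dominates a linear function for large arguments, so over a probability measure
`L^Φ` embeds continuously in `L¹`. Hence `F` is the restriction to `L^Φ` of the Fourier transform
`T` on `L¹`, and `ν(A) = T χ_A` depends on `T` alone.

One inclusion of the optimal domain holds for any bounded `T` on `L¹`: since `‖χ_A‖₁ = m(A)`, each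
`|⟨ν, x'⟩|` is at most `‖x'‖ ‖T‖ m`, so integrable functions are `ν`-integrable, and `∫_A f dν = T(f
χ_A)` by density of simple functions (`integral_scalar_operatorMeasure`). This also identifies `I_ν`
with `T` on `L¹`.

The reverse inclusion comes from the trivial representation: the coefficient of `χ_A` there is
`m(A)` times the identity, so a single functional turns `ν` into `m` (`exists_dual_fourierC0_eq`).
Integrability against that one scalar measure is integrability against `m`, and rescaling the
functional into the unit ball gives the lower norm bound. No lower estimate of the norms on the
operator spaces is needed.

The analytic input is the Riemann–Lebesgue lemma, by which `T` takes values in `c₀`. On `L²` it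
follows from Bessel's inequality for one matrix coefficient per class, these being orthogonal by
Schur's lemma. It passes to `L¹` because simple functions are dense and `c₀` is closed in `ℓ^∞`. -/

noncomputable section

open scoped InnerProductSpace

/-! ### The vector measure of an operator on `L¹` -/

namespace MeasureTheory

section OperatorMeasure

variable {α : Type*} [MeasurableSpace α] {μ : Measure α} [IsFiniteMeasure μ]
  {X : Type*} [NormedAddCommGroup X] [NormedSpace ℂ X]

open Classical in
variable (μ) in
/-- The `L¹`-valued vector measure `A ↦ χ_A`. -/
def indicatorVectorMeasure : VectorMeasure α (Lp ℂ 1 μ) :=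
  VectorMeasure.of_additive_of_le_measure (μ := μ)
    (fun A => if hA : MeasurableSet A then indicatorConstLp 1 hA (measure_ne_top μ A) 1 else 0)
    (fun A => by
      by_cases hA : MeasurableSet A
      · simp only [hA, dite_true]
        rw [← ofReal_norm, norm_indicatorConstLp one_ne_zero ENNReal.one_ne_top]
        simp [Measure.real]
      · simp [hA])
    (fun A B hA hB hAB => by
      simp only [hA, hB, hA.union hB, dite_true]
      exact indicatorConstLp_disjoint_union hA hB _ _ hAB 1)
    (fun A hA => by simp [hA])

theorem indicatorVectorMeasure_apply {A : Set α} (hA : MeasurableSet A) :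
    indicatorVectorMeasure μ A = indicatorConstLp 1 hA (measure_ne_top μ A) 1 :=
  dif_pos hA

/-- The vector measure `A ↦ T χ_A` of an operator `T` on `L¹`. -/
def operatorMeasure (T : Lp ℂ 1 μ →L[ℂ] X) : VectorMeasure α X :=
  (indicatorVectorMeasure μ).mapRange (T : Lp ℂ 1 μ →+ X) T.continuous

variable (T : Lp ℂ 1 μ →L[ℂ] X)

theorem operatorMeasure_apply {A : Set α} (hA : MeasurableSet A) :
    operatorMeasure T A = T (indicatorConstLp 1 hA (measure_ne_top μ A) 1) := by
  rw [← indicatorVectorMeasure_apply hA]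
  rfl

theorem scalar_operatorMeasure_apply (x' : StrongDual ℂ X) {A : Set α} (hA : MeasurableSet A) :
    (operatorMeasure T).scalar x' A
      = x' (T (indicatorConstLp 1 hA (measure_ne_top μ A) 1)) := by
  rw [← operatorMeasure_apply T hA]
  rfl

/-- The `L¹`-norm of `χ_A` is exactly `μ(A)`, so the operator bound is already a bound by a measure.
Integrability and almost-everywhere equality therefore pass from `μ` to every scalar measure at
once. -/
theorem variation_scalar_operatorMeasure_le (x' : StrongDual ℂ X) :
    ((operatorMeasure T).scalar x').variation ≤ ((‖x'‖₊ * ‖T‖₊ : ℝ≥0) : ℝ≥0∞) • μ := by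
  refine VectorMeasure.variation_le_of_forall_enorm_le fun A hA => ?_
  rw [scalar_operatorMeasure_apply T x' hA, ← ofReal_norm, Measure.smul_apply, smul_eq_mul]
  have h1 : ‖x' (T (indicatorConstLp 1 hA (measure_ne_top μ A) 1))‖
      ≤ (‖x'‖ * ‖T‖) * μ.real A := by
    refine (x'.le_opNorm _).trans ?_
    rw [mul_assoc]
    gcongr
    refine (T.le_opNorm _).trans ?_
    rw [norm_indicatorConstLp one_ne_zero ENNReal.one_ne_top]
    simp
  refine (ENNReal.ofReal_le_ofReal h1).trans (le_of_eq ?_)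
  rw [ENNReal.ofReal_mul (by positivity), ofReal_measureReal]
  congr 1
  rw [← coe_nnnorm, ← coe_nnnorm, ← NNReal.coe_mul, ENNReal.ofReal_coe_nnreal]

/-- Both sides are additive and continuous in `f` for the `L¹(μ)`-norm and agree on multiples of
indicators, by the definition of the measure. -/
theorem integral_scalar_operatorMeasure (x' : StrongDual ℂ X) (f : Lp ℂ 1 μ) :
    ((operatorMeasure T).scalar x').integral f (ContinuousLinearMap.mul ℝ ℂ) = x' (T f) := by
  set σ := (operatorMeasure T).scalar x' with hσ
  set K : ℝ≥0∞ := ((‖x'‖₊ * ‖T‖₊ : ℝ≥0) : ℝ≥0∞) with hK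
  have hKt : K ≠ ∞ := ENNReal.coe_ne_top
  have hle : σ.variation ≤ K • μ := variation_scalar_operatorMeasure_le T x'
  have hint : ∀ g : α → ℂ, Integrable g μ → Integrable g σ.variation :=
    fun g hg => hg.of_measure_le_smul hKt hle
  have hcongr : ∀ {g h : α → ℂ}, g =ᵐ[μ] h →
      σ.integral g (ContinuousLinearMap.mul ℝ ℂ) = σ.integral h (ContinuousLinearMap.mul ℝ ℂ) :=
    fun hgh => VectorMeasure.integral_congr_ae
      ((Measure.absolutelyContinuous_of_le_smul hle).ae_eq hgh)
  induction f using Lp.induction ENNReal.one_ne_top with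
  | @indicatorConst c A hA hμA =>
    have h1 : (Lp.simpleFunc.indicatorConst 1 hA hμA.ne c : Lp ℂ 1 μ)
        = c • indicatorConstLp 1 hA hμA.ne 1 := by
      rw [Lp.simpleFunc.coe_indicatorConst]
      ext1
      filter_upwards [Lp.coeFn_smul c (indicatorConstLp 1 hA hμA.ne (1 : ℂ)),
        indicatorConstLp_coeFn (p := 1) (hs := hA) (hμs := hμA.ne) (c := c),
        indicatorConstLp_coeFn (p := 1) (hs := hA) (hμs := hμA.ne) (c := (1 : ℂ))] with t h2 h3 h4
      rw [h2, h3, Pi.smul_apply, h4]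
      by_cases ht : t ∈ A <;> simp [ht]
    have h2 : ((Lp.simpleFunc.indicatorConst 1 hA hμA.ne c : Lp ℂ 1 μ) : α → ℂ)
        =ᵐ[μ] A.indicator fun _ => c := by
      rw [Lp.simpleFunc.coe_indicatorConst]
      exact indicatorConstLp_coeFn
    have : IsFiniteMeasure (σ.restrict A).variation := by
      have := @isFiniteMeasure_of_le _ _ _ ((‖x'‖₊ * ‖T‖₊) • μ) _ hle
      rw [VectorMeasure.variation_restrict hA]
      infer_instance
    rw [hcongr h2, VectorMeasure.integral_indicator hA, VectorMeasure.integral_const,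
      VectorMeasure.restrict_apply _ hA MeasurableSet.univ, Set.univ_inter, h1,
      scalar_operatorMeasure_apply T x' hA]
    simp
  | @add f g hf hg _ ihf ihg =>
    have hf' := hint _ (L1.integrable_coeFn (hf.toLp f))
    have hg' := hint _ (L1.integrable_coeFn (hg.toLp g))
    rw [hcongr (Lp.coeFn_add _ _), VectorMeasure.integral_add hf' hg', ihf, ihg, map_add, map_add]
  | isClosed =>
    refine isClosed_eq ?_ (x'.continuous.comp T.continuous)
    -- The integral is built over the variation of `σ`, whereas continuity is wanted on `L¹(μ)`. As
    -- the variation is at most `K • μ`, the same set function is dominated by `μ`, and the integral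
    -- is also its extension over `μ`.
    have hT : DominatedFinMeasAdditive μ (σ.transpose (ContinuousLinearMap.mul ℝ ℂ))
        (K.toReal * ‖ContinuousLinearMap.mul ℝ ℂ‖) := by
      have h := dominatedFinMeasAdditive_cbmApplyMeasure σ
        (ContinuousLinearMap.mul ℝ ℂ)
      exact DominatedFinMeasAdditive.of_measure_le_smul hKt hle h
        (ContinuousLinearMap.opNorm_nonneg _)
    have : (fun f : Lp ℂ 1 μ => σ.integral f (ContinuousLinearMap.mul ℝ ℂ))
        = fun f : Lp ℂ 1 μ => setToFun μ _ hT f := by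
      ext f
      exact (setToFun_congr_measure_of_integrable K hKt hle hT _ f (L1.integrable_coeFn f)).symm
    rw [this]
    exact continuous_setToFun hT

theorem isIntegralOn_operatorMeasure {f : α → ℂ} (hf : Integrable f μ) {A : Set α}
    (hA : MeasurableSet A) :
    (operatorMeasure T).IsIntegralOn f A (T ((hf.indicator hA).toL1 _)) := by
  intro x'
  rw [VectorMeasure.scalarIntegral, ← VectorMeasure.integral_indicator hA,
    ← integral_scalar_operatorMeasure]
  exact VectorMeasure.integral_congr_ae ((Measure.absolutelyContinuous_of_le_smul
    (variation_scalar_operatorMeasure_le T x')).ae_eq (hf.indicator hA).coeFn_toL1.symm)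

theorem isIntegrable_operatorMeasure {f : α → ℂ} (hf : Integrable f μ) :
    (operatorMeasure T).IsIntegrable f := by
  refine ⟨fun x' => hf.of_measure_le_smul ENNReal.coe_ne_top
    (variation_scalar_operatorMeasure_le T x'), fun A hA =>
    ⟨_, isIntegralOn_operatorMeasure T hf hA, fun y hy => ?_⟩⟩
  -- Uniqueness of the value holds because functionals separate points.
  refine (SeparatingDual.eq_iff_forall_dual_eq (R := ℂ)).2 fun x' => ?_
  rw [← hy x', isIntegralOn_operatorMeasure T hf hA x']

theorem integrationOperator_operatorMeasure {f : α → ℂ} (hf : Integrable f μ) :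
    (operatorMeasure T).integrationOperator f = T (hf.toL1 f) := by
  have h := isIntegrable_operatorMeasure T hf
  rw [VectorMeasure.integrationOperator, dif_pos h]
  have h1 := (h.2 Set.univ MeasurableSet.univ).unique
    (h.2 Set.univ MeasurableSet.univ).choose_spec.1
    (isIntegralOn_operatorMeasure T hf MeasurableSet.univ)
  rw [h1]
  simp only [Set.indicator_univ]

theorem l1Norm_operatorMeasure_le (f : α → ℂ) :
    (operatorMeasure T).l1Norm f ≤ ‖T‖₊ * eLpNorm f 1 μ := by
  refine iSup₂_le fun x' hx' => ?_
  refine (lintegral_mono' (variation_scalar_operatorMeasure_le T x') le_rfl).trans ?_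
  rw [lintegral_smul_measure, eLpNorm_one_eq_lintegral_enorm, smul_eq_mul]
  gcongr
  exact mul_le_of_le_one_left zero_le hx'

end OperatorMeasure

/-! ### Lower bounds for `L¹(ν)` from a single functional -/

namespace VectorMeasure

variable {α : Type*} [MeasurableSpace α] {μ : Measure α}
  {X : Type*} [NormedAddCommGroup X] [NormedSpace ℂ X] {ν : VectorMeasure α X}

/-- The variation of a set is at least the modulus of its measure, so a setwise lower bound on the
scalar measure is inherited by its variation. -/
theorem le_smul_variation_scalar {x' : StrongDual ℂ X} {r : ℝ≥0} (hr : r ≠ 0)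
    (h : ∀ A, MeasurableSet A → r * μ A ≤ ‖x' (ν A)‖ₑ) :
    μ ≤ ((r⁻¹ : ℝ≥0) : ℝ≥0∞) • (ν.scalar x').variation := by
  refine Measure.le_iff.2 fun A hA => ?_
  have h1 : r * μ A ≤ (ν.scalar x').variation A :=
    (h A hA).trans (enorm_measure_le_variation (ν.scalar x') A)
  rw [Measure.smul_apply, smul_eq_mul]
  calc μ A = ((r⁻¹ : ℝ≥0) : ℝ≥0∞) * (r * μ A) := by
        rw [← mul_assoc, ← ENNReal.coe_mul, inv_mul_cancel₀ hr, ENNReal.coe_one, one_mul]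
    _ ≤ _ := by gcongr

theorem IsIntegrable.integrable_of_le {x' : StrongDual ℂ X} {r : ℝ≥0} (hr : r ≠ 0)
    (h : ∀ A, MeasurableSet A → r * μ A ≤ ‖x' (ν A)‖ₑ) {f : α → ℂ} (hf : ν.IsIntegrable f) :
    MeasureTheory.Integrable f μ :=
  (hf.1 x').of_measure_le_smul ENNReal.coe_ne_top (le_smul_variation_scalar hr h)

theorem mul_eLpNorm_le_l1Norm {x' : StrongDual ℂ X} (hx' : ‖x'‖ ≤ 1) {r : ℝ≥0} (hr : r ≠ 0)
    (h : ∀ A, MeasurableSet A → r * μ A ≤ ‖x' (ν A)‖ₑ) (f : α → ℂ) :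
    r * eLpNorm f 1 μ ≤ ν.l1Norm f := by
  refine le_trans ?_ (le_iSup₂ (f := fun (x' : StrongDual ℂ X) (_ : x' ∈ {x' | ‖x'‖ ≤ 1}) =>
    ∫⁻ t, ‖f t‖ₑ ∂(ν.scalar x').variation) x' hx')
  rw [eLpNorm_one_eq_lintegral_enorm]
  calc r * ∫⁻ t, ‖f t‖ₑ ∂μ
      ≤ r * ∫⁻ t, ‖f t‖ₑ ∂(((r⁻¹ : ℝ≥0) : ℝ≥0∞) • (ν.scalar x').variation) := by
        gcongr
        exact le_smul_variation_scalar hr h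
    _ = ∫⁻ t, ‖f t‖ₑ ∂(ν.scalar x').variation := by
        rw [lintegral_smul_measure, smul_eq_mul, ← mul_assoc, ← ENNReal.coe_mul,
          mul_inv_cancel₀ hr, ENNReal.coe_one, one_mul]

theorem exists_dual_norm_le_one [IsFiniteMeasure μ] {y' : StrongDual ℂ X}
    (h : ∀ A, MeasurableSet A → y' (ν A) = μ.real A) :
    ∃ (x' : StrongDual ℂ X) (r : ℝ≥0), ‖x'‖ ≤ 1 ∧ r ≠ 0 ∧
      ∀ A, MeasurableSet A → r * μ A ≤ ‖x' (ν A)‖ₑ := by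
  -- The factor that puts `y'` in the unit ball is also the constant of the lower bound; the added
  -- `1` keeps it positive when `y' = 0`.
  set r : ℝ≥0 := (1 + ‖y'‖₊)⁻¹ with hr
  refine ⟨((r : ℝ) : ℂ) • y', r, ?_, by positivity, fun A hA => ?_⟩
  · have h1 : r * ‖y'‖₊ ≤ 1 := by
      rw [hr, inv_mul_eq_div]
      exact div_le_one_of_le₀ le_add_self zero_le
    rw [norm_smul, Complex.norm_real, NNReal.norm_eq]
    exact_mod_cast h1
  · change _ ≤ ‖((r : ℝ) : ℂ) * y' (ν A)‖ₑ
    rw [h A hA, enorm_mul, ← ofReal_norm, ← ofReal_norm, Complex.norm_real, Complex.norm_real,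
      NNReal.norm_eq, Real.norm_of_nonneg measureReal_nonneg, ENNReal.ofReal_coe_nnreal,
      ofReal_measureReal]

end VectorMeasure

end MeasureTheory

/-! ### Schur's lemma, orthogonality of matrix coefficients, Bessel's inequality -/

namespace UnitaryIrrep

variable {G : Type*} [Group G] [TopologicalSpace G]

/-- The underlying algebraic representation. -/
def toRepresentation (π : UnitaryIrrep G) : Representation ℂ G π.Space :=
  (ContinuousLinearMap.toLinearMapRingHom : (π.Space →L[ℂ] π.Space) →+* _).toMonoidHom.comp
    ((unitary _).subtype.comp π.toHom)

instance (π : UnitaryIrrep G) : π.toRepresentation.IsIrreducible := π.irreducible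

theorem op_mul (π : UnitaryIrrep G) (s t : G) (v : π.Space) :
    π.op (s * t) v = π.op s (π.op t v) :=
  congrArg (fun S : π.Space → π.Space => S v)
    (congrArg (fun S : unitary (π.Space →L[ℂ] π.Space) => ⇑(S : π.Space →L[ℂ] π.Space))
      (map_mul π.toHom s t))

theorem op_inv (π : UnitaryIrrep G) (t : G) : π.op t⁻¹ = star (π.op t) := by
  rw [op, map_inv, ← Unitary.star_eq_inv]
  rfl

theorem op_one (π : UnitaryIrrep G) (v : π.Space) : π.op 1 v = v := by simp [op]

theorem inner_op_left (π : UnitaryIrrep G) (t : G) (v w : π.Space) :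
    ⟪π.op t v, w⟫_ℂ = ⟪v, π.op t⁻¹ w⟫_ℂ := by
  rw [op_inv, ContinuousLinearMap.star_eq_adjoint, ContinuousLinearMap.adjoint_inner_right]

theorem norm_op_apply (π : UnitaryIrrep G) (t : G) (v : π.Space) : ‖π.op t v‖ = ‖v‖ := by
  rw [@norm_eq_sqrt_re_inner ℂ, @norm_eq_sqrt_re_inner ℂ, inner_op_left, ← op_mul,
    inv_mul_cancel, op_one]

theorem norm_op_le (π : UnitaryIrrep G) (t : G) : ‖π.op t‖ ≤ 1 :=
  ContinuousLinearMap.opNorm_le_bound _ zero_le_one fun v => by rw [norm_op_apply, one_mul]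

theorem norm_star_op_le (π : UnitaryIrrep G) (t : G) : ‖star (π.op t)‖ ≤ 1 :=
  op_inv π t ▸ π.norm_op_le t⁻¹

theorem continuous_op (π : UnitaryIrrep G) : Continuous π.op :=
  continuous_clm_apply.2 π.continuous'

/-- A nonzero intertwiner between irreducible unitary representations yields a unitary one. -/
theorem equiv_of_intertwining_ne_zero {π σ : UnitaryIrrep G} (T : π.Space →L[ℂ] σ.Space)
    (hT : ∀ t v, T (π.op t v) = σ.op t (T v)) (hT0 : T ≠ 0) : π ≈ σ := by
  let I : π.toRepresentation.IntertwiningMap σ.toRepresentation :=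
    ⟨T.toLinearMap, fun t => LinearMap.ext (hT t)⟩
  have hI0 : I ≠ 0 := fun h => hT0 (ContinuousLinearMap.ext fun v =>
    congrArg (fun J : π.toRepresentation.IntertwiningMap σ.toRepresentation => J v) h)
  have hsurj : Function.Surjective T :=
    ((Representation.IsIrreducible.bijective_or_eq_zero I).resolve_right hI0).2
  have hadj : ∀ t w, ContinuousLinearMap.adjoint T (σ.op t w)
      = π.op t (ContinuousLinearMap.adjoint T w) := by
    intro t w
    refine ext_inner_left ℂ fun v => ?_
    rw [ContinuousLinearMap.adjoint_inner_right, ← inv_inv t, ← inner_op_left, ← hT,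
      ← inner_op_left, ContinuousLinearMap.adjoint_inner_right]
  -- By unitarity the adjoint of `T` also intertwines, so `T* T` commutes with `π` and is a scalar
  -- `c`. Then `‖T v‖² = Re c ‖v‖²`, and `T` divided by `√(Re c)` is the required isometry; working
  -- with `Re c` spares a proof that `c` is real.
  let J : π.toRepresentation.IntertwiningMap π.toRepresentation :=
    ⟨(ContinuousLinearMap.adjoint T ∘L T).toLinearMap, fun t => LinearMap.ext fun v => by
      change ContinuousLinearMap.adjoint T (T (π.op t v))
        = π.op t (ContinuousLinearMap.adjoint T (T v))
      rw [hT, hadj]⟩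
  obtain ⟨c, hc⟩ := (Representation.IsIrreducible.algebraMap_intertwiningMap_bijective_of_isAlgClosed
    (ρ := π.toRepresentation) (k := ℂ)).2 J
  have hJ : ∀ v, ContinuousLinearMap.adjoint T (T v) = c • v := fun v => by
    have := congrArg (fun J : π.toRepresentation.IntertwiningMap π.toRepresentation => J v) hc
    exact this.symm
  have hnorm : ∀ v, ‖T v‖ ^ 2 = c.re * ‖v‖ ^ 2 := by
    intro v
    have h1 : ⟪v, ContinuousLinearMap.adjoint T (T v)⟫_ℂ = ⟪T v, T v⟫_ℂ :=
      ContinuousLinearMap.adjoint_inner_right _ _ _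
    rw [hJ, inner_smul_right, inner_self_eq_norm_sq_to_K, inner_self_eq_norm_sq_to_K] at h1
    have h2 := congrArg Complex.re h1
    norm_cast at h2
    have h3 : (c * ((‖v‖ ^ 2 : ℝ) : ℂ)).re = ((‖T v‖ ^ 2 : ℝ) : ℂ).re := h2
    rw [Complex.re_mul_ofReal, Complex.ofReal_re] at h3
    exact h3.symm
  obtain ⟨v₀, hv₀⟩ : ∃ v, T v ≠ 0 := by
    by_contra! h
    exact hT0 (ContinuousLinearMap.ext h)
  have hcpos : 0 < c.re := by
    have h1 : 0 < ‖T v₀‖ ^ 2 := by positivity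
    rw [hnorm] at h1
    exact pos_of_mul_pos_left h1 (by positivity)
  set r : ℝ := (√c.re)⁻¹ with hr
  have hrpos : 0 < r := inv_pos.2 (Real.sqrt_pos.2 hcpos)
  let U : π.Space →ₗᵢ[ℂ] σ.Space :=
    { toLinearMap := ((r : ℂ) • T).toLinearMap
      norm_map' := fun v => by
        have h1 : ‖T v‖ = √c.re * ‖v‖ := by
          rw [← Real.sqrt_sq (norm_nonneg (T v)), hnorm, Real.sqrt_mul hcpos.le,
            Real.sqrt_sq (norm_nonneg v)]
        change ‖(r : ℂ) • T v‖ = ‖v‖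
        rw [norm_smul, h1, Complex.norm_real, Real.norm_of_nonneg hrpos.le, hr,
          inv_mul_cancel_left₀ (Real.sqrt_pos.2 hcpos).ne'] }
  have hU : Function.Surjective U := fun w => by
    obtain ⟨v, hv⟩ := hsurj ((r : ℂ)⁻¹ • w)
    refine ⟨v, ?_⟩
    change (r : ℂ) • T v = w
    rw [hv, smul_inv_smul₀ (by exact_mod_cast hrpos.ne')]
  refine ⟨LinearIsometryEquiv.ofSurjective U hU, fun t v => ?_⟩
  change (r : ℂ) • T (π.op t v) = σ.op t ((r : ℂ) • T v)
  rw [hT, map_smul]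

variable [IsTopologicalGroup G] [CompactSpace G] [MeasurableSpace G] [BorelSpace G]

/-- Matrix coefficients of inequivalent irreducible unitary representations are orthogonal. -/
theorem integral_inner_op_mul_inner_op (m : Measure G) [m.IsMulLeftInvariant] [IsFiniteMeasure m]
    {π σ : UnitaryIrrep G} (h : ¬ π ≈ σ) (u v : π.Space) (u' v' : σ.Space) :
    ∫ t, ⟪π.op t u, v⟫_ℂ * ⟪v', σ.op t u'⟫_ℂ ∂m = 0 := by
  have hcont : ∀ v, Continuous fun t => ⟪π.op t u, v⟫_ℂ • σ.op t u' := fun v =>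
    Continuous.smul (f := fun t => ⟪π.op t u, v⟫_ℂ)
      ((π.continuous' u).inner continuous_const) (σ.continuous' u')
  have hint : ∀ v, Integrable (fun t => ⟪π.op t u, v⟫_ℂ • σ.op t u') m := fun v =>
    (hcont v).integrable_of_hasCompactSupport (HasCompactSupport.of_compactSpace _)
  -- The average over `t` of `σ(t) R π(t)*`, where `R` is the rank-one operator `v ↦ ⟪u, v⟫ u'`.
  -- Left invariance of `m` makes it an intertwiner, so it vanishes for inequivalent
  -- representations.
  let T : π.Space →ₗ[ℂ] σ.Space :=
    { toFun := fun v => ∫ t, ⟪π.op t u, v⟫_ℂ • σ.op t u' ∂m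
      map_add' := fun v w => by
        rw [← integral_add (hint v) (hint w)]
        simp only [inner_add_right, add_smul]
      map_smul' := fun c v => by
        rw [RingHom.id_apply, ← integral_smul]
        simp only [inner_smul_right, mul_smul] }
  have hT : ∀ t v, T.toContinuousLinearMap (π.op t v) = σ.op t (T.toContinuousLinearMap v) := by
    intro s v
    change ∫ t, ⟪π.op t u, π.op s v⟫_ℂ • σ.op t u' ∂m
      = σ.op s (∫ t, ⟪π.op t u, v⟫_ℂ • σ.op t u' ∂m)
    rw [← ContinuousLinearMap.integral_comp_comm _ (hint v),
      ← integral_mul_left_eq_self (fun t => ⟪π.op t u, π.op s v⟫_ℂ • σ.op t u') s]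
    refine integral_congr_ae (Eventually.of_forall fun t => ?_)
    change ⟪π.op (s * t) u, π.op s v⟫_ℂ • σ.op (s * t) u' = σ.op s (⟪π.op t u, v⟫_ℂ • σ.op t u')
    rw [map_smul, op_mul, op_mul, inner_op_left, ← op_mul, inv_mul_cancel, op_one]
  have h0 : T.toContinuousLinearMap = 0 := by
    by_contra hne
    exact h (equiv_of_intertwining_ne_zero _ hT hne)
  have h1 : ⟪v', T v⟫_ℂ = 0 := by
    have : T v = 0 := congrArg (fun S : π.Space →L[ℂ] σ.Space => S v) h0
    rw [this, inner_zero_right]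
  rw [← h1]
  change _ = ⟪v', ∫ t, ⟪π.op t u, v⟫_ℂ • σ.op t u' ∂m⟫_ℂ
  rw [← integral_inner (hint v)]
  simp only [inner_smul_right]

end UnitaryIrrep

/-- Bessel's inequality for an orthogonal family in the unit ball. -/
theorem sum_norm_inner_sq_le_of_orthogonal {ι H : Type*} [NormedAddCommGroup H]
    [InnerProductSpace ℂ H] {φ : ι → H} (hφ : ∀ i, ‖φ i‖ ≤ 1)
    (horth : ∀ i j, i ≠ j → ⟪φ i, φ j⟫_ℂ = 0) (f : H) (s : Finset ι) :
    ∑ i ∈ s, ‖⟪φ i, f⟫_ℂ‖ ^ 2 ≤ ‖f‖ ^ 2 := by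
  set S := ∑ i ∈ s, ‖⟪φ i, f⟫_ℂ‖ ^ 2 with hS
  set g := ∑ i ∈ s, ⟪φ i, f⟫_ℂ • φ i with hg
  have h1 : ⟪g, f⟫_ℂ = (S : ℂ) := by
    rw [hg, sum_inner, hS, Complex.ofReal_sum]
    refine Finset.sum_congr rfl fun i _ => ?_
    rw [inner_smul_left, mul_comm, Complex.mul_conj, Complex.normSq_eq_norm_sq]
  have h2 : ‖g‖ ^ 2 ≤ S := by
    have h3 : ⟪g, g⟫_ℂ = ((∑ i ∈ s, ‖⟪φ i, f⟫_ℂ‖ ^ 2 * ‖φ i‖ ^ 2 : ℝ) : ℂ) := by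
      nth_rw 1 [hg]
      rw [sum_inner, Complex.ofReal_sum]
      refine Finset.sum_congr rfl fun i hi => ?_
      rw [inner_smul_left, hg, inner_sum, Finset.sum_eq_single i]
      · rw [inner_smul_right, inner_self_eq_norm_sq_to_K, ← mul_assoc, mul_comm (starRingEnd ℂ _),
          Complex.mul_conj, Complex.normSq_eq_norm_sq]
        push_cast
        rfl
      · intro j _ hji
        rw [inner_smul_right, horth i j hji.symm, mul_zero]
      · exact fun h => absurd hi h
    rw [inner_self_eq_norm_sq_to_K] at h3
    have h4 : ‖g‖ ^ 2 = ∑ i ∈ s, ‖⟪φ i, f⟫_ℂ‖ ^ 2 * ‖φ i‖ ^ 2 := by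
      rw [← Complex.ofReal_inj, ← h3, Complex.ofReal_pow]
      rfl
    rw [h4, hS]
    refine Finset.sum_le_sum fun i _ => mul_le_of_le_one_right (by positivity) ?_
    exact pow_le_one₀ (norm_nonneg _) (hφ i)
  have hS0 : 0 ≤ S := Finset.sum_nonneg fun i _ => by positivity
  have h5 : S ≤ ‖g‖ * ‖f‖ := by
    have := norm_inner_le_norm (𝕜 := ℂ) g f
    rwa [h1, Complex.norm_real, Real.norm_of_nonneg hS0] at this
  -- `2S ≤ 2‖g‖‖f‖ ≤ ‖g‖² + ‖f‖² ≤ S + ‖f‖²`; this form needs no normalization of the `φ i`, some of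
  -- which may vanish.
  nlinarith [sq_nonneg (‖g‖ - ‖f‖)]

/-! ### The trivial representation; Fourier coefficients as `L²` inner products -/

namespace UnitaryIrrep

variable {G : Type*} [Group G] [TopologicalSpace G]

/-- The trivial representation on `ℂ`. -/
def trivial (G : Type*) [Group G] [TopologicalSpace G] : UnitaryIrrep G where
  dim := 1
  toHom := 1
  continuous' _ := continuous_const
  irreducible := by
    have hs : IsSimpleModule ℂ (EuclideanSpace ℂ (Fin 1)) :=
      isSimpleModule_iff_finrank_eq_one.2 (by simp)
    have hs' := (isSimpleModule_iff ..).1 hs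
    refine { exists_pair_ne := ⟨⊥, ⊤, fun h => ?_⟩, eq_bot_or_eq_top := fun W => ?_ }
    · exact (bot_ne_top (α := Submodule ℂ (EuclideanSpace ℂ (Fin 1))))
        (congrArg Subrepresentation.toSubmodule h)
    · rcases eq_bot_or_eq_top W.toSubmodule with h | h
      · exact Or.inl (Subrepresentation.toSubmodule_injective h)
      · exact Or.inr (Subrepresentation.toSubmodule_injective h)

/-- The representative chosen for the trivial class is known only up to equivalence, hence the
hypothesis in this form. -/
theorem op_eq_one_of_equiv_trivial {π : UnitaryIrrep G} (h : π ≈ trivial G) (t : G) :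
    π.op t = 1 := by
  obtain ⟨U, hU⟩ := h
  ext1 v
  exact U.injective (hU t v)

theorem nontrivial_of_equiv_trivial {π : UnitaryIrrep G} (h : π ≈ trivial G) :
    Nontrivial π.Space := by
  obtain ⟨U, -⟩ := h
  have : Nontrivial (EuclideanSpace ℂ (Fin 1)) := inferInstance
  exact U.toEquiv.nontrivial_congr.2 this

variable [MeasurableSpace G] (π : UnitaryIrrep G) {m : Measure G}

theorem fourierCoeff_congr {f g : G → ℂ} (h : f =ᵐ[m] g) :
    π.fourierCoeff m f = π.fourierCoeff m g :=
  integral_congr_ae (h.mono fun t ht => by simp only [ht])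

theorem fourierCoeff_smul (c : ℂ) (f : G → ℂ) :
    π.fourierCoeff m (c • f) = c • π.fourierCoeff m f := by
  rw [fourierCoeff, fourierCoeff, ← integral_smul]
  simp only [Pi.smul_apply, smul_assoc]

theorem norm_fourierCoeff_le {f : G → ℂ} (hf : Integrable f m) :
    ‖π.fourierCoeff m f‖ ≤ ∫ t, ‖f t‖ ∂m := by
  refine norm_integral_le_of_norm_le hf.norm (Eventually.of_forall fun t => ?_)
  rw [norm_smul]
  exact mul_le_of_le_one_right (norm_nonneg _) (π.norm_star_op_le t)

theorem fourierCoeff_of_equiv_trivial {π : UnitaryIrrep G} (h : π ≈ trivial G) (f : G → ℂ) :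
    π.fourierCoeff m f = (∫ t, f t ∂m) • (1 : π.Space →L[ℂ] π.Space) := by
  rw [fourierCoeff, ← integral_smul_const f (1 : π.Space →L[ℂ] π.Space)]
  simp only [op_eq_one_of_equiv_trivial h, star_one]

variable [BorelSpace G]

theorem memLp_inner_op [IsProbabilityMeasure m] (u v : π.Space) :
    MemLp (fun t => ⟪v, π.op t u⟫_ℂ) 2 m :=
  MemLp.of_bound (continuous_const.inner (π.continuous' u)).aestronglyMeasurable (‖v‖ * ‖u‖)
    (Eventually.of_forall fun t => (norm_inner_le_norm _ _).trans_eq (by rw [norm_op_apply]))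

/-- The matrix coefficient `t ↦ ⟨v, π(t) u⟩` as an element of `L²`. -/
def matrixCoeff (m : Measure G) [IsProbabilityMeasure m] (u v : π.Space) : Lp ℂ 2 m :=
  (π.memLp_inner_op u v).toLp _

theorem norm_matrixCoeff_le [IsProbabilityMeasure m] {u v : π.Space} (hu : ‖u‖ ≤ 1)
    (hv : ‖v‖ ≤ 1) : ‖π.matrixCoeff m u v‖ ≤ 1 := by
  have h := Lp.norm_le_of_ae_bound (f := π.matrixCoeff m u v) zero_le_one (by
    filter_upwards [(π.memLp_inner_op (m := m) u v).coeFn_toLp] with t ht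
    rw [matrixCoeff, ht]
    refine (norm_inner_le_norm _ _).trans ?_
    rw [norm_op_apply]
    exact mul_le_one₀ hv (norm_nonneg _) hu)
  simpa [measureUnivNNReal] using h

variable [IsTopologicalGroup G]

theorem integrable_smul_star_op {f : G → ℂ} (hf : Integrable f m) :
    Integrable (fun t => f t • star (π.op t)) m := by
  have hc : Continuous fun t => star (π.op t) := by
    simp only [← op_inv]
    exact π.continuous_op.comp continuous_inv
  exact hf.smul_bdd 1 hc.aestronglyMeasurable (Eventually.of_forall π.norm_star_op_le)

theorem fourierCoeff_add {f g : G → ℂ} (hf : Integrable f m) (hg : Integrable g m) :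
    π.fourierCoeff m (f + g) = π.fourierCoeff m f + π.fourierCoeff m g := by
  rw [fourierCoeff, fourierCoeff, fourierCoeff,
    ← integral_add (π.integrable_smul_star_op hf) (π.integrable_smul_star_op hg)]
  exact integral_congr_ae (Eventually.of_forall fun t => add_smul (f t) (g t) (star (π.op t)))

theorem inner_fourierCoeff {f : G → ℂ} (hf : Integrable f m) (u v : π.Space) :
    ⟪u, π.fourierCoeff m f v⟫_ℂ = ∫ t, f t * ⟪π.op t u, v⟫_ℂ ∂m := by
  have hint := π.integrable_smul_star_op hf
  rw [fourierCoeff, ContinuousLinearMap.integral_apply hint,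
    ← integral_inner (hint.apply_continuousLinearMap v)]
  refine integral_congr_ae (Eventually.of_forall fun t => ?_)
  change ⟪u, f t • (star (π.op t)) v⟫_ℂ = f t * ⟪π.op t u, v⟫_ℂ
  rw [inner_smul_right, ContinuousLinearMap.star_eq_adjoint,
    ContinuousLinearMap.adjoint_inner_right]

/-- This turns entries of the Fourier coefficient into inner products in `L²`, where Bessel's
inequality applies. -/
theorem inner_matrixCoeff_toLp [IsProbabilityMeasure m] {f : G → ℂ} (hf : MemLp f 2 m)
    (u v : π.Space) : ⟪π.matrixCoeff m u v, hf.toLp f⟫_ℂ = ⟪u, π.fourierCoeff m f v⟫_ℂ := by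
  rw [π.inner_fourierCoeff (hf.integrable (by norm_num)), L2.inner_def]
  refine integral_congr_ae ?_
  filter_upwards [(π.memLp_inner_op (m := m) u v).coeFn_toLp, hf.coeFn_toLp] with t h1 h2
  rw [matrixCoeff, h1, h2, RCLike.inner_apply, inner_conj_symm]

variable [CompactSpace G]

theorem inner_matrixCoeff_matrixCoeff [IsProbabilityMeasure m] [m.IsMulLeftInvariant]
    {π σ : UnitaryIrrep G} (h : ¬ π ≈ σ) (u v : π.Space) (u' v' : σ.Space) :
    ⟪π.matrixCoeff m u v, σ.matrixCoeff m u' v'⟫_ℂ = 0 := by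
  rw [← integral_inner_op_mul_inner_op m h u v u' v', L2.inner_def]
  refine integral_congr_ae ?_
  filter_upwards [(π.memLp_inner_op (m := m) u v).coeFn_toLp,
    (σ.memLp_inner_op (m := m) u' v').coeFn_toLp] with t h1 h2
  rw [matrixCoeff, matrixCoeff, h1, h2, RCLike.inner_apply, inner_conj_symm, mul_comm]

end UnitaryIrrep

/-- One matrix entry controls the operator norm up to a factor `2`: take `v` in the unit ball with
`‖T v‖ > ‖T‖ / 2` and `u` the direction of `T v`. The factor avoids asking that the norm be
attained. -/
theorem ContinuousLinearMap.exists_norm_le_two_mul_inner {H : Type*} [NormedAddCommGroup H]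
    [InnerProductSpace ℂ H] (T : H →L[ℂ] H) :
    ∃ u v : H, ‖u‖ ≤ 1 ∧ ‖v‖ ≤ 1 ∧ ‖T‖ ≤ 2 * ‖⟪u, T v⟫_ℂ‖ := by
  rcases eq_or_ne T 0 with rfl | hT
  · exact ⟨0, 0, by simp, by simp, by simp⟩
  have hpos : 0 < ‖T‖ := norm_pos_iff.2 hT
  obtain ⟨v, hv, hTv⟩ := T.exists_lt_apply_of_lt_opNorm (half_lt_self hpos)
  have hTv0 : 0 < ‖T v‖ := (half_pos hpos).trans hTv
  refine ⟨((‖T v‖⁻¹ : ℝ) : ℂ) • T v, v, ?_, hv.le, ?_⟩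
  · rw [norm_smul, Complex.norm_real, norm_inv, norm_norm, inv_mul_cancel₀ hTv0.ne']
  · rw [inner_smul_left, norm_mul, RCLike.norm_conj, Complex.norm_real, norm_inv, norm_norm,
      inner_self_eq_norm_sq_to_K, norm_pow, RCLike.norm_ofReal, abs_norm, sq,
      inv_mul_cancel_left₀ hTv0.ne']
    linarith

/-! ### The Riemann–Lebesgue lemma and the Fourier transform into `c₀` -/

namespace UnitaryDual

variable {G : Type*} [Group G] [TopologicalSpace G] [IsTopologicalGroup G] [CompactSpace G]
  [MeasurableSpace G] [BorelSpace G] {m : Measure G} [m.IsMulLeftInvariant]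
  [IsProbabilityMeasure m]

/-- The Riemann–Lebesgue lemma for square integrable functions. -/
theorem tendsto_fourierCoeff_of_memLp_two {f : G → ℂ} (hf : MemLp f 2 m) :
    Tendsto (fun p : UnitaryDual G => ‖p.rep.fourierCoeff m f‖) cofinite (𝓝 0) := by

  -- The vectors may depend on `f`: with one entry per class, orthogonality between distinct classes
  -- is all that Bessel's inequality needs, and no dimension factor appears.
  choose u v hu hv h using fun p : UnitaryDual G =>
    (p.rep.fourierCoeff m f).exists_norm_le_two_mul_inner
  have hsum : Summable fun p : UnitaryDual G =>
      ‖⟪p.rep.matrixCoeff m (u p) (v p), hf.toLp f⟫_ℂ‖ ^ 2 :=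
    summable_of_sum_le (fun p => by positivity) (sum_norm_inner_sq_le_of_orthogonal
      (fun p : UnitaryDual G => p.rep.norm_matrixCoeff_le (hu p) (hv p))
      (fun p q hpq => UnitaryIrrep.inner_matrixCoeff_matrixCoeff
        (fun hr => hpq ((Quotient.out_equiv_out (s := UnitaryIrrep.setoid)).1 hr)) _ _ _ _) (hf.toLp f))
  have h0 := hsum.tendsto_cofinite_zero.sqrt.const_mul 2
  simp only [Real.sqrt_sq (norm_nonneg _), Real.sqrt_zero, mul_zero,
    UnitaryIrrep.inner_matrixCoeff_toLp] at h0
  exact squeeze_zero (fun _ => norm_nonneg _) h h0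

end UnitaryDual

section C0

variable {ι : Type*} (V : ι → Type*) [∀ i, NormedAddCommGroup (V i)] [∀ i, NormedSpace ℂ (V i)]

theorem isClosed_c0Sum : IsClosed (c0Sum V : Set (lp V ∞)) := by
  refine isClosed_of_closure_subset fun x hx => ?_
  change Tendsto (fun i => ‖x i‖) cofinite (𝓝 0)
  refine Metric.tendsto_nhds.2 fun ε hε => ?_
  obtain ⟨y, hy, hxy⟩ := Metric.mem_closure_iff.1 hx (ε / 2) (half_pos hε)
  have hy' : Tendsto (fun i => ‖y i‖) cofinite (𝓝 0) := hy
  filter_upwards [Metric.tendsto_nhds.1 hy' (ε / 2) (half_pos hε)] with i hi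
  rw [Real.dist_0_eq_abs, abs_norm] at hi ⊢
  have h1 : ‖x i - y i‖ ≤ ‖x - y‖ := lp.norm_apply_le_norm ENNReal.top_ne_zero (x - y) i
  rw [dist_eq_norm] at hxy
  have h2 : ‖x i‖ ≤ ‖x i - y i‖ + ‖y i‖ := norm_le_norm_sub_add _ _
  linarith

end C0

namespace UnitaryDual

variable {G : Type*} [Group G] [TopologicalSpace G] [MeasurableSpace G] (m : Measure G)
  {V : UnitaryDual G → Type*} [∀ p, NormedAddCommGroup (V p)] [∀ p, NormedSpace ℂ (V p)]
  (e : ∀ p : UnitaryDual G, p.Operators ≃ₗ[ℂ] V p) {C : ℝ}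
  (hC : ∀ (p : UnitaryDual G) (T : p.Operators), ‖e p T‖ ≤ C * ‖T‖)

include hC in
-- The absolute value of `C` gives a nonnegative bound although no sign is assumed.
theorem norm_fourierCoeff_le (f : Lp ℂ 1 m) (p : UnitaryDual G) :
    ‖e p (p.rep.fourierCoeff m f)‖ ≤ |C| * ‖f‖ := by
  refine (hC p _).trans ((mul_le_mul_of_nonneg_right (le_abs_self C) (norm_nonneg _)).trans ?_)
  rw [L1.norm_eq_integral_norm]
  gcongr
  exact p.rep.norm_fourierCoeff_le (L1.integrable_coeFn f)

variable [IsTopologicalGroup G] [BorelSpace G]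

/-- The Fourier transform on `L¹`, with values in the `ℓ^∞`-direct sum. -/
def fourierLpInfty : Lp ℂ 1 m →L[ℂ] lp V ∞ :=
  LinearMap.mkContinuous
    { toFun := fun f => ⟨fun p => e p (p.rep.fourierCoeff m f), memℓp_infty ⟨|C| * ‖f‖, by
        rintro _ ⟨p, rfl⟩
        exact norm_fourierCoeff_le m e hC f p⟩⟩
      map_add' := fun f g => by
        ext p
        change e p (p.rep.fourierCoeff m (f + g : Lp ℂ 1 m))
          = e p (p.rep.fourierCoeff m f) + e p (p.rep.fourierCoeff m g)
        rw [p.rep.fourierCoeff_congr (Lp.coeFn_add f g), ← map_add,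
          p.rep.fourierCoeff_add (L1.integrable_coeFn f) (L1.integrable_coeFn g)]
      map_smul' := fun c f => by
        ext p
        change e p (p.rep.fourierCoeff m (c • f : Lp ℂ 1 m)) = c • e p (p.rep.fourierCoeff m f)
        rw [p.rep.fourierCoeff_congr (Lp.coeFn_smul c f), ← map_smul, p.rep.fourierCoeff_smul] }
    |C| fun f => lp.norm_le_of_forall_le (by positivity) (norm_fourierCoeff_le m e hC f)

theorem fourierLpInfty_apply (f : Lp ℂ 1 m) (p : UnitaryDual G) :
    fourierLpInfty m e hC f p = e p (p.rep.fourierCoeff m f) := rfl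

variable [CompactSpace G] [m.IsMulLeftInvariant] [IsProbabilityMeasure m]

/-- The Riemann–Lebesgue lemma. -/
theorem fourierLpInfty_mem_c0Sum (f : Lp ℂ 1 m) : fourierLpInfty m e hC f ∈ c0Sum V := by
  induction f using Lp.induction ENNReal.one_ne_top with
  | @indicatorConst c A hA hμA =>
    -- Indicators of measurable sets lie in `L²`, so the `L²` case covers the generators of `L¹`.
    have h := (tendsto_fourierCoeff_of_memLp_two (m := m)
      (memLp_indicator_const 2 hA c (Or.inr hμA.ne))).const_mul |C|
    rw [mul_zero] at h
    refine squeeze_zero (fun p => norm_nonneg _) (fun p => ?_) h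
    rw [fourierLpInfty_apply, Lp.simpleFunc.coe_indicatorConst,
      p.rep.fourierCoeff_congr indicatorConstLp_coeFn]
    exact (hC p _).trans (mul_le_mul_of_nonneg_right (le_abs_self C) (norm_nonneg _))
  | @add f g hf hg _ ihf ihg =>
    rw [map_add]
    exact (c0Sum V).add_mem ihf ihg
  | isClosed => exact (isClosed_c0Sum V).preimage (fourierLpInfty m e hC).continuous

/-- The Fourier transform on `L¹`, with values in the `c₀`-direct sum. -/
def fourierC0 : Lp ℂ 1 m →L[ℂ] c0Sum V :=
  (fourierLpInfty m e hC).codRestrict (c0Sum V) (fourierLpInfty_mem_c0Sum m e hC)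

theorem fourierC0_apply (f : Lp ℂ 1 m) (p : UnitaryDual G) :
    (fourierC0 m e hC f : lp V ∞) p = e p (p.rep.fourierCoeff m f) := rfl

/-- The coefficient at the trivial representation recovers the Haar measure. -/
theorem exists_dual_fourierC0_eq : ∃ x' : StrongDual ℂ (c0Sum V), ∀ A (hA : MeasurableSet A),
    x' (fourierC0 m e hC (indicatorConstLp 1 hA (measure_ne_top m A) 1)) = m.real A := by
  let p : UnitaryDual G := Quotient.mk UnitaryIrrep.setoid (UnitaryIrrep.trivial G)
  have hp : p.rep ≈ UnitaryIrrep.trivial G := Quotient.mk_out (s := UnitaryIrrep.setoid) _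
  have := UnitaryIrrep.nontrivial_of_equiv_trivial hp
  -- Injectivity of `e p` suffices: a functional equal to `1` at the image of the identity reads off
  -- `m(A)`, whatever the norm on `V p`.
  have hne : e p 1 ≠ 0 := (map_ne_zero_iff _ (e p).injective).2 one_ne_zero
  obtain ⟨l, hl⟩ := SeparatingDual.exists_eq_one (R := ℂ) hne
  refine ⟨l ∘L lp.evalCLM ℂ V ∞ p ∘L (c0Sum V).subtypeL, fun A hA => ?_⟩
  change l (e p (p.rep.fourierCoeff m _)) = _
  rw [UnitaryIrrep.fourierCoeff_of_equiv_trivial hp, map_smul, map_smul, hl,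
    integral_indicatorConstLp]
  simp

end UnitaryDual

/-! ### Embedding the Orlicz space in `L¹` -/

namespace YoungFunction

/-- A Young function dominates a linear function for large arguments. -/
theorem exists_le_add_mul (Φ : YoungFunction) :
    ∃ c : ℝ≥0, ∀ x : ℝ≥0, (x : ℝ≥0∞) ≤ c + c * Φ x := by
  -- Choose `c > 0` with `Φ c > 1`; convexity and `Φ 0 = 0` then give `Φ x ≥ (x / c) Φ c > x / c`
  -- for `x ≥ c`.
  obtain ⟨c, hc0, hc⟩ := ((eventually_gt_atTop (0 : ℝ≥0)).and
    (Φ.tendsto_top.eventually (lt_mem_nhds ENNReal.one_lt_top))).exists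
  refine ⟨c, fun x => ?_⟩
  rcases le_total x c with hx | hx
  · exact (ENNReal.coe_le_coe.2 hx).trans le_self_add
  · have hx0 : x ≠ 0 := (hc0.trans_le hx).ne'
    have h1 : (1 : ℝ≥0∞) ≤ (c / x : ℝ≥0) * Φ x := by
      have h := Φ.map_mul_le (a := c / x) (div_le_one_of_le₀ hx zero_le) x
      rw [div_mul_cancel₀ _ hx0] at h
      exact hc.le.trans h
    calc (x : ℝ≥0∞) = x * 1 := (mul_one _).symm
      _ ≤ x * ((c / x : ℝ≥0) * Φ x) := by gcongr
      _ = c * Φ x := by rw [← mul_assoc, ← ENNReal.coe_mul, mul_div_cancel₀ _ hx0]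
      _ ≤ c + c * Φ x := le_add_self

end YoungFunction

namespace OrliczSpace

variable {α : Type*} [MeasurableSpace α] {μ : Measure α} [IsProbabilityMeasure μ]

/-- For admissible `k`, integrating `x ≤ c + c Φ(x)` at `x = |f| / k` over total mass `1` yields
`‖f‖₁ ≤ 2 c k`; then take the infimum over `k`. -/
theorem exists_eLpNorm_one_le (Φ : YoungFunction) : ∃ c : ℝ≥0, ∀ f : OrliczSpace Φ μ,
    eLpNorm f.toAEEqFun 1 μ ≤ c * ENNReal.ofReal ‖f‖ := by
  obtain ⟨c, hc⟩ := Φ.exists_le_add_mul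
  refine ⟨c + c, fun f => ?_⟩
  have h1 : ∀ k ∈ luxemburgSet Φ μ f.toAEEqFun, eLpNorm f.toAEEqFun 1 μ ≤ ((c + c) * k : ℝ≥0) := by
    rintro k ⟨hk, hk1⟩
    have hm : Measurable fun t => Φ (‖f.toAEEqFun t‖₊ / k) :=
      Φ.measurable.comp (f.toAEEqFun.stronglyMeasurable.measurable.nnnorm.div_const k)
    have h2 : ∀ t, ‖f.toAEEqFun t‖ₑ ≤ k * (c + c * Φ (‖f.toAEEqFun t‖₊ / k)) := fun t => by
      calc ‖f.toAEEqFun t‖ₑ = k * ((‖f.toAEEqFun t‖₊ / k : ℝ≥0) : ℝ≥0∞) := by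
            rw [← ENNReal.coe_mul, mul_div_cancel₀ _ hk.ne']
            rfl
        _ ≤ _ := by gcongr; exact hc _
    rw [eLpNorm_one_eq_lintegral_enorm]
    calc ∫⁻ t, ‖f.toAEEqFun t‖ₑ ∂μ
        ≤ ∫⁻ t, k * (c + c * Φ (‖f.toAEEqFun t‖₊ / k)) ∂μ := lintegral_mono h2
      _ = k * (c + c * orliczModular Φ μ f.toAEEqFun k) := by
          rw [lintegral_const_mul _ (by fun_prop), lintegral_add_left measurable_const,
            lintegral_const_mul _ hm, lintegral_const, measure_univ, mul_one]
          rfl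
      _ ≤ k * (c + c * 1) := by gcongr
      _ = ((c + c) * k : ℝ≥0) := by rw [mul_one, mul_comm]; push_cast; rfl
  have hfin : eLpNorm f.toAEEqFun 1 μ ≠ ∞ := by
    obtain ⟨k, hk⟩ := f.luxemburgSet_nonempty
    exact ne_top_of_le_ne_top ENNReal.coe_ne_top (h1 k hk)
  rw [norm_def, ENNReal.ofReal_coe_nnreal, ← ENNReal.coe_toNNReal hfin, ← ENNReal.coe_mul,
    ENNReal.coe_le_coe]
  have h3 : ∀ k ∈ luxemburgSet Φ μ f.toAEEqFun, (eLpNorm f.toAEEqFun 1 μ).toNNReal ≤ (c + c) * k :=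
    fun k hk => ENNReal.toNNReal_mono ENNReal.coe_ne_top (h1 k hk)
  rcases eq_or_ne (c + c) 0 with h0 | h0
  · obtain ⟨k, hk⟩ := f.luxemburgSet_nonempty
    simpa [h0] using h3 k hk
  · rw [← div_le_iff₀' (pos_iff_ne_zero.2 h0)]
    refine le_csInf f.luxemburgSet_nonempty fun k hk => ?_
    rw [div_le_iff₀' (pos_iff_ne_zero.2 h0)]
    exact h3 k hk

/-- The continuous inclusion of an Orlicz space of a probability measure in `L¹`. -/
theorem exists_toL1 (Φ : YoungFunction) :
    ∃ J : OrliczSpace Φ μ →L[ℂ] Lp ℂ 1 μ, ∀ f, (J f : α →ₘ[μ] ℂ) = f.toAEEqFun := by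
  obtain ⟨c, hc⟩ := exists_eLpNorm_one_le (μ := μ) Φ
  let J : OrliczSpace Φ μ →ₗ[ℂ] Lp ℂ 1 μ :=
    { toFun := fun f => ⟨f.toAEEqFun, Lp.mem_Lp_iff_eLpNorm_lt_top.2
        ((hc f).trans_lt (ENNReal.mul_lt_top ENNReal.coe_lt_top ENNReal.ofReal_lt_top))⟩
      map_add' := fun f g => rfl
      map_smul' := fun a f => rfl }
  refine ⟨J.mkContinuous c fun f => ?_, fun f => rfl⟩
  rw [Lp.norm_def]
  refine (ENNReal.toReal_mono (by finiteness) (hc f)).trans ?_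
  rw [ENNReal.toReal_mul, ENNReal.coe_toReal, ENNReal.toReal_ofReal (norm_nonneg _)]

end OrliczSpace

end

theorem mainTheorem5 {G : Type*} [Group G] [TopologicalSpace G] [IsTopologicalGroup G]
    [CompactSpace G] [T2Space G] [MeasurableSpace G] [BorelSpace G]
    (m : Measure G) [m.IsHaarMeasure] [m.Regular] [IsProbabilityMeasure m]
    (Φ : YoungFunction) (hΦ : Φ.DeltaTwo)
    (V : UnitaryDual G → Type*) [∀ p, NormedAddCommGroup (V p)] [∀ p, NormedSpace ℂ (V p)]
    (e : ∀ p : UnitaryDual G, p.Operators ≃ₗ[ℂ] V p) (C : ℝ) (hC : ∀ (p : UnitaryDual G) (T : p.Operators), ‖e p T‖ ≤ C * ‖T‖) :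
    ∃ F : OrliczSpace Φ m →L[ℂ] c0Sum V,
      (∀ f p, (F f : lp V ∞) p = e p (p.rep.fourierCoeff m f.toAEEqFun)) ∧
      ∃ ν : VectorMeasure G (c0Sum V),
        (∀ A (hA : MeasurableSet A), ν A = F (OrliczSpace.indicator Φ m A hA)) ∧
        (∀ f : G → ℂ, ν.IsIntegrable f ↔ Integrable f m) ∧
        (∃ a b : ℝ≥0, 0 < a ∧ ∀ f : G → ℂ, Integrable f m →
          a * eLpNorm f 1 m ≤ ν.l1Norm f ∧ ν.l1Norm f ≤ b * eLpNorm f 1 m) ∧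
        ∀ f : G → ℂ, Integrable f m →
          ∀ p, (ν.integrationOperator f : lp V ∞) p = e p (p.rep.fourierCoeff m f) := by
  obtain ⟨J, hJ⟩ := OrliczSpace.exists_toL1 (μ := m) Φ
  set T := UnitaryDual.fourierC0 m e hC with hT
  obtain ⟨y', hy'⟩ := UnitaryDual.exists_dual_fourierC0_eq m e hC
  obtain ⟨x', r, hx', hr0, hxA⟩ := VectorMeasure.exists_dual_norm_le_one (μ := m)
    (ν := operatorMeasure T) (y' := y') fun A hA => by rw [operatorMeasure_apply T hA, hy' A hA]
  -- The lower constant `r` comes from the trivial representation, the upper one is the norm of the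
  -- transform on `L¹`.
  refine ⟨T ∘L J, fun f p => ?_, operatorMeasure T, fun A hA => ?_, fun f =>
    ⟨fun hf => hf.integrable_of_le hr0 hxA, isIntegrable_operatorMeasure T⟩,
    ⟨r, ‖T‖₊, pos_iff_ne_zero.2 hr0, fun f _ =>
      ⟨VectorMeasure.mul_eLpNorm_le_l1Norm hx' hr0 hxA f, l1Norm_operatorMeasure_le T f⟩⟩,
    fun f hf p => ?_⟩
  · change (T (J f) : lp V ∞) p = _
    rw [hT, UnitaryDual.fourierC0_apply, hJ]
  · rw [operatorMeasure_apply T hA]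
    change _ = T (J _)
    congr 1
    refine Subtype.ext ?_
    rw [hJ]
    rfl
  · rw [integrationOperator_operatorMeasure T hf, hT, UnitaryDual.fourierC0_apply,
      p.rep.fourierCoeff_congr hf.coeFn_toL1]
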